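/- Let $(\Gamma,d)$ be a countable metric space. To each $x\in\Gamma$ associate a finite-dimensional complex Hilbert space $\mathcal H_x$; for finite $\Lambda\subset\Gamma$ put $\mathcal H_\Lambda=\bigotimes_{x\in\Lambda}\mathcal H_x$ and $\mathcal A_\Lambda=\mathcal B(\mathcal H_\Lambda)$ with the operator norm. For $Z\subset\Lambda$, an observable $A\in\mathcal A_Z$ is identified with $A\otimes \mathbb 1_{\Lambda\setminus Z}\in\mathcal A_\Lambda$, and a linear map $\Phi$ on $\mathcal A_Z$ with the map $\Phi\otimes\mathrm{id}_{\Lambda\setminus Z}$ on $\mathcal A_\Lambda$. Write $\|\Phi\|_{cb}=\sup_{n\in\mathbb N}\|\Phi\otimes \mathrm{id}_{\mathbb M_n}\|$, and let $CB_0(Y)$ be the set of completely bounded linear maps $K$ on $\mathcal A_Y$ with $K(\mathbb 1_Y)=0$. Let $F:[0,\infty)\to(0,\infty)$ be an $F$-function on $(\Gamma,d)$, i.e. $F$ is non-increasing, $\sup_{x\in\Gamma}\sum_{y\in\Gamma}F(d(x,y))<\infty$, and there is $C>0$ such that $$\sum_{z\in\Gamma}F(d(x,z))F(d(z,y))\le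 C\,F(d(x,y))\qquad\text{for all }x,y\in\Gamma;$$ let $C_F$ be the infimum of all such $C$. Let $\mathscr L=\{L_Z\}$, indexed by the finite subsets $Z\subset\Gamma$, be a dissipative interaction: each $L_Z:\mathcal A_Z\to\mathcal A_Z$ is of Lindblad form $$L_Z(A)=i[H_Z,A]+\sum_{j=1}^{\ell_Z}\Big(K_j^*AK_j-\tfrac12\{K_j^*K_j,A\}\Big),\qquad H_Z=H_Z^*\in\mathcal A_Z,\quad K_1,\dots,K_{\ell_Z}\in\mathcal A_Z .$$ Let $\|\mathscr L\|_F$ be the infimum of all $M\ge 0$ with $\sum_{Z\ni x,y}\|L_Z\|_{cb}\le M\,F(d(x,y))$ for all $x,y\in\Gamma$, and assume $\|\mathscr L\|_F<\infty$. For finite $\Lambda\subset\Gamma$ and $R>0$ set $$\mathscr L^{\Lambda,R}=\sum_{Z\subset\Lambda,\ \mathrm{diam}(Z)\le R}L_Z,\qquad T^{\Lambda,R}_t=\exp\big(t\,\mathscr L^{\Lambda,R}\big),$$ and for $s\ge0$, $k\ge0$ write $\mathscr E_s(k)=\sum_{n=\lceil k\rceil}^\infty \frac{s^n}{n!}$.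 Let $X,Y\subset\Gamma$ be finite with $X\cap Y=\emptyset$, and let $d(X,Y)=\inf\{d(x,y):x\in X,\,y\in Y\}$ (read as $0$ if $X$ or $Y$ is empty). Then for every finite $\Lambda\subset\Gamma$ with $X\cup Y\subset\Lambda$, all $A\in\mathcal A_X$ and $K\in CB_0(Y)$, and all $t\ge0$ and $R>0$, $$\big\|K\big(T^{\Lambda,R}_t(A)\big)\big\|\le\frac{\|K\|_{cb}\,\|A\|}{C_F}\;\mathscr E_{vt}\!\left(\frac{d(X,Y)}{R}\right)\sum_{x\in X}\sum_{y\in Y}F(d(x,y)),\qquad v=\|\mathscr L\|_F\,C_F ,$$ where the right-hand side is read as $0$ if $\Gamma=\emptyset$. -/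

import Mathlib

open scoped NNReal ENNReal Matrix Kronecker Matrix.Norms.L2Operator

noncomputable section

namespace OpenSpin

/-! ### Completely bounded maps on matrix algebras

Square complex matrices carry the operator norm for the Euclidean norm (the C*-norm). -/

section MatrixMaps

variable {m : Type*} [Fintype m] [DecidableEq m]

/-- The map `id ⊗ Φ` on `M_n(ℂ) ⊗ M_m(ℂ)`, realised as `n × n` block matrices with entries in
`M_m(ℂ)`: the map `Φ` is applied to every block. -/
def ampliation (n : Type*) (Φ : Matrix m m ℂ →ₗ[ℂ] Matrix m m ℂ) :
    Matrix (n × m) (n × m) ℂ →ₗ[ℂ] Matrix (n × m) (n × m) ℂ :=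
  (Matrix.compLinearEquiv n n m m ℂ ℂ).toLinearMap ∘ₗ Φ.mapMatrix ∘ₗ
    (Matrix.compLinearEquiv n n m m ℂ ℂ).symm.toLinearMap

/-- The completely bounded norm `sup_n ‖Φ ⊗ 1_{n × n}‖`, with values in `[0, ∞]`. -/
def cbNorm (Φ : Matrix m m ℂ →ₗ[ℂ] Matrix m m ℂ) : ℝ≥0∞ :=
  ⨆ n : ℕ, ‖LinearMap.toContinuousLinearMap (ampliation (Fin n) Φ)‖ₑ

/-- `Φ` is of Lindblad form:
`Φ(A) = i[H, A] + ∑ⱼ (Kⱼ* A Kⱼ - ½ {Kⱼ* Kⱼ, A})` with `H` self-adjoint. -/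
def IsLindblad (Φ : Matrix m m ℂ →ₗ[ℂ] Matrix m m ℂ) : Prop :=
  ∃ H : Matrix m m ℂ, H.IsHermitian ∧ ∃ (l : ℕ) (K : Fin l → Matrix m m ℂ),
    ∀ A : Matrix m m ℂ, Φ A = Complex.I • (H * A - A * H) +
      ∑ j, ((K j)ᴴ * A * K j - (1 / 2 : ℂ) • ((K j)ᴴ * K j * A + A * ((K j)ᴴ * K j)))

end MatrixMaps

/-! ### Quantum spin systems

The finite-dimensional Hilbert space at the site `x` is `ℂ^{ι x}`, i.e. `ι x` indexes an
orthonormal basis of it.  The tensor product over a finite volume `Λ` has the product basis, which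
is indexed by the configurations `∀ x : Λ, ι x`. -/

section SpinSystem

variable {Γ : Type*} [DecidableEq Γ] (ι : Γ → Type*) [∀ x, Fintype (ι x)] [∀ x, DecidableEq (ι x)]

/-- Indices of the product basis of `⨂_{x ∈ Λ} ℂ^{ι x}`. -/
abbrev Config (Λ : Finset Γ) : Type _ := ∀ x : Λ, ι x

/-- The algebra of observables in the finite volume `Λ`, with its C*-norm. -/
abbrev LocalAlg (Λ : Finset Γ) : Type _ := Matrix (Config ι Λ) (Config ι Λ) ℂ

variable {ι}

/-- For `Z ⊆ Λ`, a configuration on `Λ` is a pair of configurations on `Λ \ Z` and on `Z`; this is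
the factorisation `H_Λ = H_{Λ \ Z} ⊗ H_Z`. -/
def splitConfig {Z Λ : Finset Γ} (h : Z ⊆ Λ) :
    Config ι Λ ≃ Config ι (Λ \ Z) × Config ι Z where
  toFun σ := (fun x => σ ⟨x, (Finset.mem_sdiff.1 x.2).1⟩, fun x => σ ⟨x, h x.2⟩)
  invFun p x := if hx : (x : Γ) ∈ Z then p.2 ⟨x, hx⟩ else p.1 ⟨x, Finset.mem_sdiff.2 ⟨x.2, hx⟩⟩
  left_inv σ := by
    funext x
    by_cases hx : (x : Γ) ∈ Z <;> simp [hx]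
  right_inv p := by
    refine Prod.ext ?_ ?_
    · funext x
      have hx : (x : Γ) ∉ Z := (Finset.mem_sdiff.1 x.2).2
      simp [hx]
    · funext x
      simp

/-- The embedding `A_Z → A_Λ`, `A ↦ 1_{Λ \ Z} ⊗ A`, for `Z ⊆ Λ`. -/
def embed {Z Λ : Finset Γ} (h : Z ⊆ Λ) (A : LocalAlg ι Z) : LocalAlg ι Λ :=
  ((1 : LocalAlg ι (Λ \ Z)) ⊗ₖ A).submatrix (splitConfig h) (splitConfig h)

/-- The map `id_{Λ \ Z} ⊗ Φ` on `A_Λ` that a map `Φ` on `A_Z` induces, for `Z ⊆ Λ`. -/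
def extend {Z Λ : Finset Γ} (h : Z ⊆ Λ) (Φ : LocalAlg ι Z →ₗ[ℂ] LocalAlg ι Z) :
    LocalAlg ι Λ →ₗ[ℂ] LocalAlg ι Λ :=
  let e := Matrix.reindexLinearEquiv ℂ ℂ (splitConfig (ι := ι) h) (splitConfig (ι := ι) h)
  e.symm.toLinearMap ∘ₗ ampliation (Config ι (Λ \ Z)) Φ ∘ₗ e.toLinearMap

/-- `CB₀(Y)`: the completely bounded maps on `A_Y` that vanish at the identity. -/
def CB₀ (Y : Finset Γ) : Set (LocalAlg ι Y →ₗ[ℂ] LocalAlg ι Y) :=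
  {K | cbNorm K < ∞ ∧ K 1 = 0}

/-- The family `L` is a dissipative interaction: each `L_Z` is of Lindblad form on `A_Z`. -/
def IsDissipativeInteraction (L : ∀ Z : Finset Γ, LocalAlg ι Z →ₗ[ℂ] LocalAlg ι Z) : Prop :=
  ∀ Z, IsLindblad (L Z)

end SpinSystem

/-! ### Decay functions and dynamics -/

section Metric

variable {Γ : Type*} [MetricSpace Γ]

/-- `C` satisfies `∑_z F(d(x,z)) F(d(z,y)) ≤ C F(d(x,y))` for all `x, y`. -/
def IsConvBound (Γ : Type*) [MetricSpace Γ] (F : ℝ≥0 → ℝ≥0) (C : ℝ≥0) : Prop :=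
  ∀ x y : Γ, ∑' z : Γ, (F (nndist x z) * F (nndist z y) : ℝ≥0∞) ≤ C * F (nndist x y)

/-- `F : [0, ∞) → (0, ∞)` is an `F`-function on `Γ`. -/
structure IsFFunction (Γ : Type*) [MetricSpace Γ] (F : ℝ≥0 → ℝ≥0) : Prop where
  pos : ∀ r, 0 < F r
  antitone : Antitone F
  uniformlySummable : ⨆ x : Γ, ∑' y : Γ, (F (nndist x y) : ℝ≥0∞) < ∞
  convolution : ∃ C : ℝ≥0, 0 < C ∧ IsConvBound Γ F C

/-- The convolution constant `C_F`. -/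
def convConst (Γ : Type*) [MetricSpace Γ] (F : ℝ≥0 → ℝ≥0) : ℝ≥0 :=
  sInf {C : ℝ≥0 | 0 < C ∧ IsConvBound Γ F C}

/-- The distance `d(X, Y) = inf {d(x, y) : x ∈ X, y ∈ Y}` (and `0` if `X` or `Y` is empty). -/
def setDist (X Y : Finset Γ) : ℝ := ⨅ p : X × Y, dist (p.1 : Γ) (p.2 : Γ)

variable [DecidableEq Γ] {ι : Γ → Type*} [∀ x, Fintype (ι x)] [∀ x, DecidableEq (ι x)]

/-- The `F`-norm `‖𝓛‖_F ∈ [0, ∞]`: the infimum of the `M` such that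
`∑_{Z ∋ x, y} ‖L_Z‖_cb ≤ M F(d(x,y))` for all `x, y`. -/
def FNorm (F : ℝ≥0 → ℝ≥0) (L : ∀ Z : Finset Γ, LocalAlg ι Z →ₗ[ℂ] LocalAlg ι Z) : ℝ≥0∞ :=
  sInf {M : ℝ≥0∞ | ∀ x y : Γ,
    ∑' Z : {Z : Finset Γ // x ∈ Z ∧ y ∈ Z}, cbNorm (L Z) ≤ M * F (nndist x y)}

/-- The generator `𝓛^{Λ,R} = ∑_{Z ⊆ Λ, diam Z ≤ R} L_Z` on `A_Λ`. -/
def truncGen (L : ∀ Z : Finset Γ, LocalAlg ι Z →ₗ[ℂ] LocalAlg ι Z) (Λ : Finset Γ) (R : ℝ) :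
    LocalAlg ι Λ →ₗ[ℂ] LocalAlg ι Λ :=
  ∑ Z ∈ Λ.powerset.attach with Metric.diam (Z.1 : Set Γ) ≤ R,
    extend (Finset.mem_powerset.1 Z.2) (L Z.1)

/-- The dynamics `T_t^{Λ,R} = exp(t 𝓛^{Λ,R})` on `A_Λ`. -/
def truncDyn (L : ∀ Z : Finset Γ, LocalAlg ι Z →ₗ[ℂ] LocalAlg ι Z) (Λ : Finset Γ) (R t : ℝ) :
    LocalAlg ι Λ →L[ℂ] LocalAlg ι Λ :=
  NormedSpace.exp ((t : ℂ) • LinearMap.toContinuousLinearMap (truncGen L Λ R))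

end Metric

/-- The tail `∑_{n ≥ ⌈k⌉} tⁿ / n!` of the exponential series. -/
def expTail (t k : ℝ) : ℝ :=
  ∑' n : {n : ℕ // ⌈k⌉₊ ≤ n}, t ^ (n : ℕ) / (Nat.factorial n : ℝ)

end OpenSpin

end

/-! Let κ be K extended to Λ, let S = ∑ E_Z be the generator, and follow f(u) = κ(exp(uS) A). Since
κ commutes with E_Z for Z disjoint from Y, f' = D f + g, where D is the sum of these E_Z and g = ∑
κ(E_Z(exp(uS) A)) runs over the Z that meet Y. Sums of Lindblad terms are dissipative, so D causes
no growth and ‖f(t)‖ ≤ ‖f(0)‖ + ∫ ‖g‖ (`IsNormDissipative.norm_le_of_hasDerivAt`); f(0) = κ(A)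
vanishes because K(1) = 0 and X, Y are disjoint. Each L_Z also kills the identity, so the same
estimate applies with E_Z and Z in the roles of κ and Y. After n rounds
(`norm_exp_apply_le_chainWeight`), ‖f(t)‖ is at most ‖K‖_cb ‖A‖ times the sum over j < n of t^j/j!
times the weight of the chains of j overlapping sets from Y to X, plus a remainder (tl)^n/n!, where
l is the total weight in Λ. The remainder tends to 0.

Two facts about chains finish the proof. Fewer than d(X,Y)/R sets of diameter at most R cannot link
Y to X (`chainWeight_eq_zero_of_lt`). The F-norm and the convolution inequality bound the weight of
the chains of j ≥ 1 sets by ‖𝓛‖_F^j C_F^(j-1) ∑∑ F(d(x,y)) (`chainWeight_succ_le`). Summing over j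
gives the exponential tail divided by C_F. -/

namespace OpenSpin

open Filter Topology Set

/-! ### Dissipative operators and a comparison principle -/

section Dissipative

variable {V : Type*} [NormedAddCommGroup V] [NormedSpace ℂ V]

/-- `1 + h D` is a contraction up to an error of second order in `h ≥ 0`. -/
def IsNormDissipative (D : V →L[ℂ] V) : Prop :=
  ∃ c : ℝ, ∀ h : ℝ, 0 ≤ h → ∀ v, ‖v + (h : ℂ) • D v‖ ≤ (1 + c * h ^ 2) * ‖v‖

theorem IsNormDissipative.zero : IsNormDissipative (0 : V →L[ℂ] V) :=
  ⟨0, fun h _ v => by simp⟩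

theorem IsNormDissipative.add {D E : V →L[ℂ] V} (hD : IsNormDissipative D)
    (hE : IsNormDissipative E) : IsNormDissipative (D + E) := by
  obtain ⟨c, hc⟩ := hD
  obtain ⟨d, hd⟩ := hE
  -- The step for D + E is the average of the steps of length 2h for D and for E; half of c(2h)² is
  -- 2ch².
  refine ⟨2 * c + 2 * d, fun h hh v => ?_⟩
  have e : v + (h : ℂ) • (D + E) v =
      (1 / 2 : ℂ) • (v + ((2 * h : ℝ) : ℂ) • D v) +
        (1 / 2 : ℂ) • (v + ((2 * h : ℝ) : ℂ) • E v) := by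
    push_cast
    change v + (h : ℂ) • (D v + E v) = _
    module
  have h1 := hc (2 * h) (by positivity) v
  have h2 := hd (2 * h) (by positivity) v
  rw [e]
  refine (norm_add_le _ _).trans ?_
  rw [norm_smul, norm_smul]
  have h3 : ‖(1 / 2 : ℂ)‖ = 1 / 2 := by simp
  rw [h3]
  nlinarith [norm_nonneg v]

theorem IsNormDissipative.sum {I : Type*} (s : Finset I) {D : I → V →L[ℂ] V}
    (hD : ∀ i ∈ s, IsNormDissipative (D i)) : IsNormDissipative (∑ i ∈ s, D i) :=
  Finset.sum_induction D IsNormDissipative (fun _ _ => .add) .zero hD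

/-- A solution of `f' = D f + g` with `D` dissipative is bounded by the integral of `‖g‖`. -/
theorem IsNormDissipative.norm_le_of_hasDerivAt {D : V →L[ℂ] V} (hD : IsNormDissipative D)
    {f g : ℝ → V} {B B' : ℝ → ℝ} (hf : ∀ s, HasDerivAt f (D (f s) + g s) s)
    (hB : ∀ s, HasDerivAt B (B' s) s) (hg : ∀ s, 0 ≤ s → ‖g s‖ ≤ B' s) (h0 : ‖f 0‖ ≤ B 0)
    {t : ℝ} (ht : 0 ≤ t) : ‖f t‖ ≤ B t := by
  obtain ⟨c, hc⟩ := hD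
  have hfc : Continuous f := continuous_iff_continuousAt.2 fun s => (hf s).continuousAt
  have hBc : Continuous B := continuous_iff_continuousAt.2 fun s => (hB s).continuousAt
  -- It suffices that the right slopes of ‖f‖ at x are eventually below any r > B'(x). The step
  -- along D costs c h²‖f x‖, g costs h B'(x), and differentiability of f leaves o(h).
  refine image_le_of_liminf_slope_right_le_deriv_boundary (f := fun s => ‖f s‖) (a := 0) (b := t)
    hfc.norm.continuousOn h0 hBc.continuousOn (fun x _ => (hB x).hasDerivWithinAt) ?_
    ⟨ht, le_rfl⟩
  intro x hx r hr
  refine Eventually.frequently ?_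
  have hslope : Tendsto (fun z => ‖slope f x z - (D (f x) + g x)‖ + c * (z - x) * ‖f x‖ + B' x)
      (𝓝[>] x) (𝓝 (B' x)) := by
    have h1 : Tendsto (fun z => ‖slope f x z - (D (f x) + g x)‖) (𝓝[>] x) (𝓝 0) := by
      have := ((hasDerivAt_iff_tendsto_slope.1 (hf x)).mono_left
        (nhdsWithin_mono x (fun y (hy : x < y) => hy.ne'))).sub_const (D (f x) + g x)
      have := this.norm
      rwa [sub_self, norm_zero] at this
    have h2 : Tendsto (fun z => c * (z - x) * ‖f x‖) (𝓝[>] x) (𝓝 0) := by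
      have : Continuous fun z => c * (z - x) * ‖f x‖ := by fun_prop
      simpa using (this.tendsto x).mono_left nhdsWithin_le_nhds
    simpa using (h1.add h2).add_const (B' x)
  filter_upwards [hslope.eventually (gt_mem_nhds hr), self_mem_nhdsWithin] with z hz hxz
  refine lt_of_le_of_lt ?_ hz
  have hh : 0 < z - x := sub_pos.2 hxz
  have hfz : f z = (f x + ((z - x : ℝ) : ℂ) • D (f x)) + (z - x) • g x +
      (z - x) • (slope f x z - (D (f x) + g x)) := by
    rw [smul_sub, sub_smul_slope, Complex.coe_smul, smul_add, vsub_eq_sub]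
    abel
  have hnorm : ‖f z‖ ≤ (1 + c * (z - x) ^ 2) * ‖f x‖ + (z - x) * B' x +
      (z - x) * ‖slope f x z - (D (f x) + g x)‖ := by
    conv_lhs => rw [hfz]
    refine (norm_add₃_le).trans ?_
    rw [norm_smul, norm_smul, Real.norm_of_nonneg hh.le]
    gcongr
    · exact hc _ hh.le _
    · exact hg x hx.1
  rw [slope_def_field, div_le_iff₀ hh]
  nlinarith

end Dissipative

/-! ### Chains of overlapping sets -/

section Chain

variable {Γ : Type*} [DecidableEq Γ]

/-- The sum of `∏ w(Zᵢ)` over the chains `Z₁, …, Zₙ` in `P` in which `Z₁` meets `Y`, each set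
meets the next one, and `Zₙ` meets `X`. -/
def chainWeight (P : Finset (Finset Γ)) (w : Finset Γ → ℝ) (X : Finset Γ) :
    ℕ → Finset Γ → ℝ
  | 0, Y => if Disjoint Y X then 0 else 1
  | n + 1, Y => ∑ Z ∈ P with ¬Disjoint Y Z, w Z * chainWeight P w X n Z

variable {P : Finset (Finset Γ)} {w : Finset Γ → ℝ} {X : Finset Γ}

theorem chainWeight_nonneg (hw : ∀ Z, 0 ≤ w Z) (n : ℕ) (Y : Finset Γ) :
    0 ≤ chainWeight P w X n Y := by
  induction n generalizing Y with
  | zero => rw [chainWeight]; split_ifs <;> norm_num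
  | succ n ih => exact Finset.sum_nonneg fun Z _ => mul_nonneg (hw Z) (ih Z)

variable {V : Type*} [NormedAddCommGroup V] [NormedSpace ℂ V] [CompleteSpace V]

theorem hasDerivAt_exp_apply (κ S : V →L[ℂ] V) (A : V) (s : ℝ) :
    HasDerivAt (fun u : ℝ => κ (NormedSpace.exp ((u : ℂ) • S) A))
      (κ (S (NormedSpace.exp ((s : ℂ) • S) A))) s := by
  have h1 : HasDerivAt (fun u : ℝ => NormedSpace.exp ((u : ℂ) • S))
      (S * NormedSpace.exp ((s : ℂ) • S)) s := by
    simpa using! (hasDerivAt_exp_smul_const' (𝕂 := ℂ) S (s : ℂ)).scomp s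
      Complex.ofRealCLM.hasDerivAt
  exact ((κ.comp (ContinuousLinearMap.apply ℂ V A)).restrictScalars ℝ).hasFDerivAt.comp_hasDerivAt
    s h1

/-- Iterating Duhamel's formula along chains of overlapping sets. -/
theorem norm_exp_apply_le_chainWeight (hw : ∀ Z, 0 ≤ w Z) {E : Finset Γ → V →L[ℂ] V}
    (hdiss : ∀ Z ∈ P, IsNormDissipative (E Z))
    (hnorm : ∀ Z ∈ P, Z.Nonempty → ∀ v, ‖E Z v‖ ≤ w Z * ‖v‖)
    (hcomm : ∀ Z ∈ P, ∀ Z' ∈ P, Disjoint Z Z' → ∀ v, E Z (E Z' v) = E Z' (E Z v))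
    {A : V} (hA : ∀ Z ∈ P, Disjoint Z X → E Z A = 0) (n : ℕ) (Y : Finset Γ) (κ : V →L[ℂ] V)
    {k : ℝ} (hk : 0 ≤ k) (hκ : ∀ v, ‖κ v‖ ≤ k * ‖v‖)
    (hκE : ∀ Z ∈ P, Disjoint Y Z → ∀ v, κ (E Z v) = E Z (κ v))
    (hκA : Disjoint Y X → κ A = 0) {t : ℝ} (ht : 0 ≤ t) :
    ‖κ (NormedSpace.exp ((t : ℂ) • ∑ Z ∈ P, E Z) A)‖ ≤ k * ‖A‖ *
      (∑ j ∈ Finset.range n, t ^ j / (j.factorial : ℝ) * chainWeight P w X j Y +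
        t ^ n / (n.factorial : ℝ) * (∑ Z ∈ P, w Z) ^ n) := by
  set S := ∑ Z ∈ P, E Z with hS
  induction n generalizing Y κ k t with
  | zero =>
    have h := (IsNormDissipative.sum P hdiss).norm_le_of_hasDerivAt
      (f := fun u : ℝ => NormedSpace.exp ((u : ℂ) • S) A) (g := 0) (B := fun _ => ‖A‖)
      (B' := fun _ => 0) (fun s =>
        (hasDerivAt_exp_apply (ContinuousLinearMap.id ℂ V) S A s).congr_deriv (add_zero _).symm)
      (fun s => hasDerivAt_const _ _) (by simp) (by simp) ht
    simpa using (hκ _).trans (mul_le_mul_of_nonneg_left h hk)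
  | succ n ih =>
    set Q := P.filter fun Z => ¬Disjoint Y Z
    set O := P.filter fun Z => Disjoint Y Z
    set l := ∑ Z ∈ P, w Z
    have hl : 0 ≤ l := Finset.sum_nonneg fun Z _ => hw Z
    -- This crude bound, which forgets that Z meets Y, enters only the remainder.
    have hQ : ∑ Z ∈ Q, w Z ≤ l :=
      Finset.sum_le_sum_of_subset_of_nonneg (Finset.filter_subset _ _) fun Z _ _ => hw Z
    -- The sets in O commute past κ and form the dissipative part; those in Q form the source. B is
    -- the integral of B' plus the term j = 0, which dominates the initial value.
    refine (IsNormDissipative.sum O fun Z hZ => hdiss Z (Finset.mem_filter.1 hZ).1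
      ).norm_le_of_hasDerivAt
      (f := fun u : ℝ => κ (NormedSpace.exp ((u : ℂ) • S) A))
      (g := fun u => ∑ Z ∈ Q, κ (E Z (NormedSpace.exp ((u : ℂ) • S) A)))
      (B := fun u => k * ‖A‖ * (∑ j ∈ Finset.range (n + 1), u ^ j / (j.factorial : ℝ) *
        chainWeight P w X j Y + u ^ (n + 1) / ((n + 1).factorial : ℝ) * l ^ (n + 1)))
      (B' := fun u => k * ‖A‖ * (∑ j ∈ Finset.range n, u ^ j / (j.factorial : ℝ) *
        chainWeight P w X (j + 1) Y + u ^ n / (n.factorial : ℝ) * l ^ (n + 1)))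
      ?_ ?_ ?_ ?_ ht
    · intro s
      convert hasDerivAt_exp_apply κ S A s using 1
      generalize NormedSpace.exp ((s : ℂ) • S) A = v
      rw [hS, _root_.sum_apply, _root_.sum_apply, map_sum,
        ← Finset.sum_filter_add_sum_filter_not P (fun Z => Disjoint Y Z)]
      congr 1
      refine Finset.sum_congr rfl fun Z hZ => ?_
      obtain ⟨hZP, hZY⟩ := Finset.mem_filter.1 hZ
      exact (hκE Z hZP hZY _).symm
    · intro s
      have hpow : ∀ j : ℕ, HasDerivAt (fun u : ℝ => u ^ (j + 1) / ((j + 1).factorial : ℝ))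
          (s ^ j / (j.factorial : ℝ)) s := fun j => by
        refine ((hasDerivAt_pow (j + 1) s).div_const ((j + 1).factorial : ℝ)).congr_deriv ?_
        rw [Nat.factorial_succ]
        have : (j.factorial : ℝ) ≠ 0 := by positivity
        push_cast
        field_simp
      refine HasDerivAt.const_mul _ (HasDerivAt.add ?_ ((hpow n).mul_const _))
      simp_rw [Finset.sum_range_succ' _ n]
      simp only [pow_zero]
      exact (HasDerivAt.fun_sum fun j _ => (hpow j).mul_const _).add_const _
    · intro s hs
      calc ‖∑ Z ∈ Q, κ (E Z (NormedSpace.exp ((s : ℂ) • S) A))‖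
          ≤ ∑ Z ∈ Q, k * (w Z * ‖A‖ * (∑ j ∈ Finset.range n, s ^ j / (j.factorial : ℝ) *
              chainWeight P w X j Z + s ^ n / (n.factorial : ℝ) * l ^ n)) := by
            refine norm_sum_le_of_le _ fun Z hZ => (hκ _).trans ?_
            obtain ⟨hZP, hZY⟩ := Finset.mem_filter.1 hZ
            -- The empty set meets nothing, so no norm bound on its term is needed.
            have hne : Z.Nonempty := by
              rw [Finset.nonempty_iff_ne_empty]
              rintro rfl
              exact hZY (Finset.disjoint_empty_right Y)
            exact mul_le_mul_of_nonneg_left (ih Z (E Z) (hw Z) (hnorm Z hZP hne)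
              (fun Z' hZ' h v => hcomm Z hZP Z' hZ' h v) (hA Z hZP) hs) hk
        _ = k * ‖A‖ * (∑ j ∈ Finset.range n, s ^ j / (j.factorial : ℝ) *
              chainWeight P w X (j + 1) Y + s ^ n / (n.factorial : ℝ) * l ^ n * ∑ Z ∈ Q, w Z) := by
            simp only [chainWeight, mul_add, Finset.mul_sum, Finset.sum_add_distrib]
            rw [Finset.sum_comm]
            congr 1
            · refine Finset.sum_congr rfl fun j _ => Finset.sum_congr rfl fun Z _ => by ring
            · refine Finset.sum_congr rfl fun Z _ => by ring
        _ ≤ _ := by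
            rw [pow_succ, ← mul_assoc (s ^ n / (n.factorial : ℝ))]
            gcongr
    · simp only [Complex.ofReal_zero, zero_smul, NormedSpace.exp_zero,
        one_apply_eq_self, Finset.sum_range_succ' _ n]
      by_cases hYX : Disjoint Y X
      · simp [hκA hYX, chainWeight, hYX]
      · simpa [chainWeight, hYX] using hκ A

end Chain

end OpenSpin

namespace OpenSpin

/-! ### Lindblad operators -/

section Lindblad

variable {m n : Type*} [Fintype m] [DecidableEq m] [Fintype n] [DecidableEq n]

/-- `A ↦ 1 ⊗ A` as a homomorphism of star algebras. -/
def kroneckerOneHom (n m : Type*) [Fintype m] [DecidableEq m] [Fintype n] [DecidableEq n] :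
    Matrix m m ℂ →⋆ₙₐ[ℂ] Matrix (n × m) (n × m) ℂ where
  toFun A := (1 : Matrix n n ℂ) ⊗ₖ A
  map_smul' c A := by simp [Matrix.kronecker_smul]
  map_zero' := by simp
  map_add' A B := by simp [Matrix.kronecker_add]
  map_mul' A B := by simp [← Matrix.mul_kronecker_mul]
  map_star' A := by simp [Matrix.star_eq_conjTranspose, Matrix.conjTranspose_kronecker]

theorem norm_one_kronecker_le (A : Matrix m m ℂ) : ‖(1 : Matrix n n ℂ) ⊗ₖ A‖ ≤ ‖A‖ :=
  NonUnitalStarAlgHom.norm_apply_le (kroneckerOneHom n m) A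

/-- Reindexing square matrices is a homomorphism of star algebras. -/
def submatrixHom (e : n ≃ m) : Matrix m m ℂ →⋆ₙₐ[ℂ] Matrix n n ℂ where
  toFun A := A.submatrix e e
  map_smul' _ _ := rfl
  map_zero' := rfl
  map_add' _ _ := rfl
  map_mul' A B := (Matrix.submatrix_mul_equiv A B e e e).symm
  map_star' _ := rfl

theorem norm_submatrix_equiv (e : n ≃ m) (A : Matrix m m ℂ) : ‖A.submatrix e e‖ = ‖A‖ := by
  refine le_antisymm (NonUnitalStarAlgHom.norm_apply_le (submatrixHom e) A) ?_
  have h : ‖(A.submatrix e e).submatrix e.symm e.symm‖ ≤ ‖A.submatrix e e‖ :=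
    NonUnitalStarAlgHom.norm_apply_le (submatrixHom e.symm) (A.submatrix e e)
  simpa using h

/-- The norm of the completely positive map `A ↦ ∑ Vᵢ* A Vᵢ` is attained at the identity. -/
theorem norm_sum_conj_le {I : Type*} [Fintype I] [DecidableEq I] (V : I → Matrix m m ℂ)
    (A : Matrix m m ℂ) : ‖∑ i, (V i)ᴴ * A * V i‖ ≤ ‖∑ i, (V i)ᴴ * V i‖ * ‖A‖ := by
  -- Stinespring form: stacking the Vᵢ in a column W turns the map into B ↦ W*(1 ⊗ B)W, whose value
  -- at 1 has norm ‖W‖².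
  let W : Matrix (I × m) m ℂ := Matrix.of fun p b => V p.1 p.2 b
  have key : ∀ B : Matrix m m ℂ, ∑ i, (V i)ᴴ * B * V i = Wᴴ * ((1 : Matrix I I ℂ) ⊗ₖ B) * W := by
    intro B
    ext a b
    simp only [Matrix.sum_apply, Matrix.mul_apply, Fintype.sum_prod_type, W,
      Matrix.conjTranspose_apply, Matrix.of_apply, Matrix.kroneckerMap_apply, Matrix.one_apply,
      ite_mul, one_mul, zero_mul, mul_ite, mul_zero, Finset.sum_ite_irrel, Finset.sum_const_zero,
      Finset.sum_ite_eq', Finset.mem_univ, if_true]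
  have h1 := key 1
  simp only [mul_one, Matrix.one_kronecker_one, Matrix.mul_one] at h1
  rw [key A, h1, Matrix.l2_opNorm_conjTranspose_mul_self]
  calc ‖Wᴴ * ((1 : Matrix I I ℂ) ⊗ₖ A) * W‖
      ≤ ‖Wᴴ‖ * ‖(1 : Matrix I I ℂ) ⊗ₖ A‖ * ‖W‖ :=
        (Matrix.l2_opNorm_mul _ _).trans (by gcongr; exact Matrix.l2_opNorm_mul _ _)
    _ ≤ ‖W‖ * ‖A‖ * ‖W‖ := by
        rw [Matrix.l2_opNorm_conjTranspose]
        gcongr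
        exact norm_one_kronecker_le A
    _ = ‖W‖ * ‖W‖ * ‖A‖ := by ring

theorem IsLindblad.map_one {Φ : Matrix m m ℂ →ₗ[ℂ] Matrix m m ℂ} (h : IsLindblad Φ) :
    Φ 1 = 0 := by
  obtain ⟨H, -, l, K, hΦ⟩ := h
  rw [hΦ]
  simp [← two_smul ℂ, smul_smul]

/-- The second-order estimate behind the contractivity of Lindblad semigroups. -/
theorem IsLindblad.norm_add_smul_le {Φ : Matrix m m ℂ →ₗ[ℂ] Matrix m m ℂ} (h : IsLindblad Φ) :
    ∃ c : ℝ, ∀ s : ℝ, 0 ≤ s → ∀ A, ‖A + (s : ℂ) • Φ A‖ ≤ (1 + c * s ^ 2) * ‖A‖ := by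
  obtain ⟨H, hH, l, K, hΦ⟩ := h
  set N := ∑ j, (K j)ᴴ * K j with hN
  have hNH : Nᴴ = N := by simp [hN, Matrix.conjTranspose_sum]
  set G : Matrix m m ℂ := -(Complex.I • H) - (1 / 2 : ℂ) • N with hG
  have hGH : Gᴴ = Complex.I • H - (1 / 2 : ℂ) • N := by
    simp [hG, hNH, hH.eq]
  have hform : ∀ A, Φ A = Gᴴ * A + A * G + ∑ j, (K j)ᴴ * A * K j := by
    intro A
    rw [hΦ, Finset.sum_sub_distrib, ← Finset.smul_sum, Finset.sum_add_distrib,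
      ← Finset.sum_mul, ← Finset.mul_sum, ← hN, hGH, hG]
    simp only [smul_sub, smul_add, sub_mul, mul_sub, Matrix.smul_mul, Matrix.mul_smul, mul_neg]
    abel
  -- The Kraus operators 1 + sG and √s Kⱼ give a completely positive map equal to A + sΦ(A) + s²
  -- G*AG. Its value at 1 is 1 + s² G*G, since G + G* + N = 0. The extra term and the excess over 1
  -- each cost s²‖G‖².
  refine ⟨2 * ‖G‖ ^ 2, fun s hs A => ?_⟩
  let V : Option (Fin l) → Matrix m m ℂ := fun o =>
    o.elim (1 + (s : ℂ) • G) fun j => ((√s : ℝ) : ℂ) • K j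
  have hsq : ((√s : ℝ) : ℂ) * ((√s : ℝ) : ℂ) = s := by
    rw [← Complex.ofReal_mul, Real.mul_self_sqrt hs]
  have hV : ∀ B, ∑ o, (V o)ᴴ * B * V o =
      (B + (s : ℂ) • (Gᴴ * B + B * G + ∑ j, (K j)ᴴ * B * K j)) +
        ((s : ℂ) ^ 2) • (Gᴴ * B * G) := by
    intro B
    have h2 : ∀ j, (V (some j))ᴴ * B * V (some j) = (s : ℂ) • ((K j)ᴴ * B * K j) := by
      intro j
      simp only [V, Option.elim, Matrix.conjTranspose_smul, Complex.star_def, Complex.conj_ofReal,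
        Matrix.smul_mul, Matrix.mul_smul, smul_smul, hsq]
    rw [Fintype.sum_option, Finset.sum_congr rfl fun j _ => h2 j, ← Finset.smul_sum]
    simp only [V, Option.elim, Matrix.conjTranspose_add, Matrix.conjTranspose_one,
      Matrix.conjTranspose_smul, Complex.star_def, Complex.conj_ofReal, add_mul, mul_add, one_mul,
      mul_one, Matrix.smul_mul, Matrix.mul_smul, smul_smul, smul_add, sq]
    abel
  have hone : ∑ o, (V o)ᴴ * V o = 1 + ((s : ℂ) ^ 2) • (Gᴴ * G) := by
    have h1 := hV 1
    simp only [mul_one] at h1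
    rw [h1, ← hN, one_mul, hGH, hG]
    congr 1
    rw [add_eq_left]
    module
  have hns : ‖(s : ℂ) ^ 2‖ = s ^ 2 := by simp
  have hVA := norm_sum_conj_le V A
  rw [hone] at hVA
  have h3 : ‖(1 : Matrix m m ℂ) + ((s : ℂ) ^ 2) • (Gᴴ * G)‖ ≤ 1 + s ^ 2 * ‖G‖ ^ 2 := by
    refine (norm_add_le _ _).trans ?_
    rw [norm_smul, hns, Matrix.l2_opNorm_conjTranspose_mul_self, ← sq]
    gcongr
    cases isEmpty_or_nonempty m
    · rw [Subsingleton.elim (1 : Matrix m m ℂ) 0]; simp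
    · exact CStarRing.norm_one.le
  have h4 : ‖((s : ℂ) ^ 2) • (Gᴴ * A * G)‖ ≤ s ^ 2 * ‖G‖ ^ 2 * ‖A‖ := by
    rw [norm_smul, hns]
    have : ‖Gᴴ * A * G‖ ≤ ‖G‖ * ‖A‖ * ‖G‖ := by
      rw [← Matrix.l2_opNorm_conjTranspose G]
      refine (norm_mul_le _ _).trans ?_
      rw [Matrix.l2_opNorm_conjTranspose G]
      gcongr
      exact (norm_mul_le _ _).trans (by rw [Matrix.l2_opNorm_conjTranspose G])
    calc s ^ 2 * ‖Gᴴ * A * G‖ ≤ s ^ 2 * (‖G‖ * ‖A‖ * ‖G‖) := by gcongr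
      _ = _ := by ring
  have h5 : A + (s : ℂ) • Φ A = ∑ o, (V o)ᴴ * A * V o - ((s : ℂ) ^ 2) • (Gᴴ * A * G) := by
    rw [hV, hform]
    abel
  rw [h5]
  refine (norm_sub_le _ _).trans ?_
  nlinarith [norm_nonneg A]

end Lindblad

end OpenSpin

namespace OpenSpin

/-! ### Norm and dissipativity of ampliations -/

section Ampliation

variable {m n : Type*}

/-- The block of `M` at the position `(i, j)`. -/
def block (M : Matrix (n × m) (n × m) ℂ) (i j : n) : Matrix m m ℂ :=
  Matrix.of fun a b => M (i, a) (j, b)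

theorem ampliation_apply (Φ : Matrix m m ℂ →ₗ[ℂ] Matrix m m ℂ) (M : Matrix (n × m) (n × m) ℂ)
    (p q : n × m) : ampliation n Φ M p q = Φ (block M p.1 q.1) p.2 q.2 := rfl

theorem apply_eq_block (M : Matrix (n × m) (n × m) ℂ) (p q : n × m) :
    M p q = block M p.1 q.1 p.2 q.2 := rfl

theorem block_add (M N : Matrix (n × m) (n × m) ℂ) (i j : n) :
    block (M + N) i j = block M i j + block N i j := rfl

theorem block_sub (M N : Matrix (n × m) (n × m) ℂ) (i j : n) :
    block (M - N) i j = block M i j - block N i j := rfl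

theorem block_smul (c : ℂ) (M : Matrix (n × m) (n × m) ℂ) (i j : n) :
    block (c • M) i j = c • block M i j := rfl

theorem block_sum {I : Type*} (s : Finset I) (M : I → Matrix (n × m) (n × m) ℂ) (i j : n) :
    block (∑ k ∈ s, M k) i j = ∑ k ∈ s, block (M k) i j := by
  ext a b
  simp [block, Matrix.sum_apply]

variable [Fintype m] [Fintype n] [DecidableEq n]

theorem block_kronecker_mul (P : Matrix m m ℂ) (M : Matrix (n × m) (n × m) ℂ) (i j : n) :
    block (((1 : Matrix n n ℂ) ⊗ₖ P) * M) i j = P * block M i j := by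
  ext a b
  simp [block, Matrix.mul_apply, Fintype.sum_prod_type, Matrix.one_apply,
    Finset.sum_ite_irrel]

theorem block_mul_kronecker (P : Matrix m m ℂ) (M : Matrix (n × m) (n × m) ℂ) (i j : n) :
    block (M * ((1 : Matrix n n ℂ) ⊗ₖ P)) i j = block M i j * P := by
  ext a b
  simp [block, Matrix.mul_apply, Fintype.sum_prod_type, Matrix.one_apply,
    Finset.sum_ite_irrel]

/-- Since A ↦ 1 ⊗ A preserves products and adjoints, tensoring H and the Kⱼ with 1 suffices.
Dissipativity in a larger volume thus needs no separate argument. -/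
theorem IsLindblad.ampliation {Φ : Matrix m m ℂ →ₗ[ℂ] Matrix m m ℂ} (h : IsLindblad Φ) :
    IsLindblad (OpenSpin.ampliation n Φ) := by
  obtain ⟨H, hH, l, K, hΦ⟩ := h
  refine ⟨(1 : Matrix n n ℂ) ⊗ₖ H, ?_, l, fun j => (1 : Matrix n n ℂ) ⊗ₖ K j, fun M => ?_⟩
  · rw [Matrix.IsHermitian, Matrix.conjTranspose_kronecker, hH.eq, Matrix.conjTranspose_one]
  · ext p q
    rw [ampliation_apply, apply_eq_block (_ + _)]
    simp only [Matrix.conjTranspose_kronecker, Matrix.conjTranspose_one, block_add, block_smul,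
      block_sub, block_sum, block_mul_kronecker, block_kronecker_mul,
      ← Matrix.mul_kronecker_mul, Matrix.one_mul, hΦ]

variable [DecidableEq m]

theorem norm_ampliation_le {Φ : Matrix m m ℂ →ₗ[ℂ] Matrix m m ℂ} (hΦ : cbNorm Φ < ∞)
    (M : Matrix (n × m) (n × m) ℂ) : ‖ampliation n Φ M‖ ≤ (cbNorm Φ).toReal * ‖M‖ := by
  -- `cbNorm` tests only the index types `Fin k`, so n is enumerated.
  let e : n × m ≃ Fin (Fintype.card n) × m := (Fintype.equivFin n).prodCongr (Equiv.refl m)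
  have h1 : ampliation n Φ M =
      (ampliation (Fin (Fintype.card n)) Φ (M.submatrix e.symm e.symm)).submatrix e e := by
    ext p q
    simp [ampliation_apply, block, e]
  rw [h1, norm_submatrix_equiv, ← norm_submatrix_equiv e.symm M]
  refine ((LinearMap.toContinuousLinearMap
    (ampliation (Fin (Fintype.card n)) Φ)).le_opNorm _).trans ?_
  gcongr
  rw [← toReal_enorm]
  exact ENNReal.toReal_mono hΦ.ne
    (le_iSup (fun k : ℕ => ‖LinearMap.toContinuousLinearMap (ampliation (Fin k) Φ)‖ₑ) _)

end Ampliation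

/-! ### Local maps and local observables -/

section Local

variable {Γ : Type*} [DecidableEq Γ] {ι : Γ → Type*} {X Y Z Λ : Finset Γ}

theorem extend_eq (h : Z ⊆ Λ) (Φ : LocalAlg ι Z →ₗ[ℂ] LocalAlg ι Z) (M : LocalAlg ι Λ) :
    extend h Φ M = (ampliation (Config ι (Λ \ Z)) Φ
      (M.submatrix (splitConfig h).symm (splitConfig h).symm)).submatrix
        (splitConfig h) (splitConfig h) := rfl

/-- The configuration that agrees with `a` on `Z` and with `σ` elsewhere. -/
def paste (h : Z ⊆ Λ) (σ : Config ι Λ) (a : Config ι Z) : Config ι Λ :=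
  (splitConfig h).symm ((splitConfig h σ).1, a)

/-- The restriction of a configuration to a smaller volume. -/
def restrict (h : Z ⊆ Λ) (σ : Config ι Λ) : Config ι Z := (splitConfig h σ).2

theorem paste_apply_mem (h : Z ⊆ Λ) (σ : Config ι Λ) (a : Config ι Z) (x : Λ) (hx : (x : Γ) ∈ Z) :
    paste h σ a x = a ⟨x, hx⟩ := by
  simp [paste, splitConfig, hx]

theorem paste_apply_notMem (h : Z ⊆ Λ) (σ : Config ι Λ) (a : Config ι Z) (x : Λ)
    (hx : (x : Γ) ∉ Z) : paste h σ a x = σ x := by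
  simp [paste, splitConfig, hx]

theorem paste_comm (hY : Y ⊆ Λ) (hZ : Z ⊆ Λ) (hYZ : Disjoint Y Z) (σ : Config ι Λ)
    (a : Config ι Y) (b : Config ι Z) :
    paste hY (paste hZ σ b) a = paste hZ (paste hY σ a) b := by
  funext x
  by_cases hx : (x : Γ) ∈ Y
  · have hx' : (x : Γ) ∉ Z := Finset.disjoint_left.1 hYZ hx
    rw [paste_apply_mem _ _ _ _ hx, paste_apply_notMem _ _ _ _ hx', paste_apply_mem _ _ _ _ hx]
  · rw [paste_apply_notMem _ _ _ _ hx]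
    by_cases hx' : (x : Γ) ∈ Z
    · rw [paste_apply_mem _ _ _ _ hx', paste_apply_mem _ _ _ _ hx']
    · rw [paste_apply_notMem _ _ _ _ hx', paste_apply_notMem _ _ _ _ hx',
        paste_apply_notMem _ _ _ _ hx]

theorem restrict_paste (hY : Y ⊆ Λ) (hZ : Z ⊆ Λ) (hYZ : Disjoint Y Z) (σ : Config ι Λ)
    (b : Config ι Z) : restrict hY (paste hZ σ b) = restrict hY σ := by
  funext x
  exact paste_apply_notMem hZ σ b ⟨x, hY x.2⟩ (Finset.disjoint_left.1 hYZ x.2)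

/-- Working with entries in configurations on Λ avoids comparing the factorisations of Λ along
different subsets. -/
theorem extend_apply (h : Z ⊆ Λ) (Φ : LocalAlg ι Z →ₗ[ℂ] LocalAlg ι Z) (M : LocalAlg ι Λ)
    (σ τ : Config ι Λ) : extend h Φ M σ τ =
      Φ (Matrix.of fun a b => M (paste h σ a) (paste h τ b)) (restrict h σ) (restrict h τ) := rfl

variable [∀ x, DecidableEq (ι x)]

theorem embed_apply (h : X ⊆ Λ) (A : LocalAlg ι X) (σ τ : Config ι Λ) :
    embed h A σ τ = if ∀ x : Λ, (x : Γ) ∉ X → σ x = τ x then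
      A (restrict h σ) (restrict h τ) else 0 := by
  have : (splitConfig h σ).1 = (splitConfig h τ).1 ↔ ∀ x : Λ, (x : Γ) ∉ X → σ x = τ x := by
    rw [funext_iff]
    exact ⟨fun H x hx => H ⟨x, Finset.mem_sdiff.2 ⟨x.2, hx⟩⟩,
      fun H x => H ⟨x, _⟩ (Finset.mem_sdiff.1 x.2).2⟩
  simp only [embed, Matrix.submatrix_apply, Matrix.kroneckerMap_apply, Matrix.one_apply, this]
  simp [restrict]

/-- A map that vanishes at the identity annihilates the observables supported off its own
support. -/
theorem extend_embed_eq_zero (hX : X ⊆ Λ) (hZ : Z ⊆ Λ) (hZX : Disjoint Z X)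
    {Φ : LocalAlg ι Z →ₗ[ℂ] LocalAlg ι Z} (hΦ : Φ 1 = 0) (A : LocalAlg ι X) :
    extend hZ Φ (embed hX A) = 0 := by
  ext σ τ
  -- The observable acts as the identity on Z, so each of its Z-slices is a multiple of 1.
  obtain ⟨c, hc⟩ : ∃ c : ℂ, (Matrix.of fun a b =>
      embed hX A (paste hZ σ a) (paste hZ τ b) : LocalAlg ι Z) = c • 1 := by
    refine ⟨if ∀ x : Λ, (x : Γ) ∉ X → (x : Γ) ∉ Z → σ x = τ x then
      A (restrict hX σ) (restrict hX τ) else 0, ?_⟩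
    ext a b
    have key : (∀ x : Λ, (x : Γ) ∉ X → paste hZ σ a x = paste hZ τ b x) ↔
        (∀ x : Λ, (x : Γ) ∉ X → (x : Γ) ∉ Z → σ x = τ x) ∧ a = b := by
      constructor
      · refine fun H => ⟨fun x hx hxZ => ?_, funext fun x => ?_⟩
        · simpa [paste_apply_notMem _ _ _ _ hxZ] using H x hx
        · simpa [paste_apply_mem] using H ⟨x, hZ x.2⟩ (Finset.disjoint_left.1 hZX x.2)
      · rintro ⟨H, rfl⟩ x hx
        by_cases hxZ : (x : Γ) ∈ Z
        · simp [paste_apply_mem _ _ _ _ hxZ]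
        · simpa [paste_apply_notMem _ _ _ _ hxZ] using H x hx hxZ
    simp only [Matrix.of_apply, embed_apply, key, restrict_paste hX hZ hZX.symm,
      Matrix.smul_apply, Matrix.one_apply, smul_eq_mul, mul_ite, mul_one, mul_zero, ite_and]
    split_ifs <;> rfl
  rw [extend_apply, hc, map_smul, hΦ, smul_zero]
  rfl

variable [∀ x, Fintype (ι x)]

theorem norm_extend_le (h : Z ⊆ Λ) {Φ : LocalAlg ι Z →ₗ[ℂ] LocalAlg ι Z} (hΦ : cbNorm Φ < ∞)
    (M : LocalAlg ι Λ) : ‖extend h Φ M‖ ≤ (cbNorm Φ).toReal * ‖M‖ := by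
  rw [extend_eq, norm_submatrix_equiv, ← norm_submatrix_equiv (splitConfig h).symm M]
  exact norm_ampliation_le hΦ _

theorem norm_embed_le (h : X ⊆ Λ) (A : LocalAlg ι X) : ‖embed h A‖ ≤ ‖A‖ := by
  rw [embed, norm_submatrix_equiv]
  exact norm_one_kronecker_le A

theorem IsLindblad.isNormDissipative_extend (h : Z ⊆ Λ) {Φ : LocalAlg ι Z →ₗ[ℂ] LocalAlg ι Z}
    (hΦ : IsLindblad Φ) : IsNormDissipative (LinearMap.toContinuousLinearMap (extend h Φ)) := by
  obtain ⟨c, hc⟩ := (hΦ.ampliation (n := Config ι (Λ \ Z))).norm_add_smul_le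
  refine ⟨c, fun s hs M => ?_⟩
  have h1 := hc s hs (M.submatrix (splitConfig h).symm (splitConfig h).symm)
  rw [norm_submatrix_equiv] at h1
  refine le_of_eq_of_le ?_ h1
  rw [← norm_submatrix_equiv (splitConfig h)]
  congr 1
  ext σ τ
  simp [extend_eq]

/-- Matrix units present the map as a finite kernel, so that commutation of disjoint maps becomes an
exchange of sums. -/
theorem extend_apply_eq_sum (h : Z ⊆ Λ) (Φ : LocalAlg ι Z →ₗ[ℂ] LocalAlg ι Z)
    (M : LocalAlg ι Λ) (σ τ : Config ι Λ) :
    extend h Φ M σ τ = ∑ p : Config ι Z × Config ι Z, M (paste h σ p.1) (paste h τ p.2) *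
      Φ (Matrix.single p.1 p.2 1) (restrict h σ) (restrict h τ) := by
  rw [extend_apply]
  conv_lhs => rw [Matrix.matrix_eq_sum_single (Matrix.of fun a b => M (paste h σ a) (paste h τ b))]
  rw [Fintype.sum_prod_type, map_sum, Matrix.sum_apply]
  refine Finset.sum_congr rfl fun a _ => ?_
  rw [map_sum, Matrix.sum_apply]
  refine Finset.sum_congr rfl fun b _ => ?_
  have : Matrix.single a b (M (paste h σ a) (paste h τ b)) =
      M (paste h σ a) (paste h τ b) • Matrix.single a b (1 : ℂ) := by simp
  rw [Matrix.of_apply, this, map_smul, Matrix.smul_apply, smul_eq_mul]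

/-- Maps with disjoint supports commute. -/
theorem extend_comm (hY : Y ⊆ Λ) (hZ : Z ⊆ Λ) (hYZ : Disjoint Y Z)
    (Φ : LocalAlg ι Y →ₗ[ℂ] LocalAlg ι Y) (Ψ : LocalAlg ι Z →ₗ[ℂ] LocalAlg ι Z)
    (M : LocalAlg ι Λ) : extend hY Φ (extend hZ Ψ M) = extend hZ Ψ (extend hY Φ M) := by
  ext σ τ
  simp only [extend_apply_eq_sum hY Φ, extend_apply_eq_sum hZ Ψ, Finset.sum_mul,
    restrict_paste hY hZ hYZ, restrict_paste hZ hY hYZ.symm, paste_comm hY hZ hYZ]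
  rw [Finset.sum_comm]
  refine Finset.sum_congr rfl fun p _ => Finset.sum_congr rfl fun q _ => by ring

end Local

end OpenSpin

namespace OpenSpin

/-! ### Bounds on chain sums -/

section ChainBound

variable {Γ : Type*} [DecidableEq Γ] {P : Finset (Finset Γ)} {w : Finset Γ → ℝ} {Λ X : Finset Γ}

/-- One link of a chain: a set meeting Y contains some y ∈ Y, and u Z is spread over the points z ∈
Z. Exchanging sums collects the sets containing both y and z, whose weight is at most b y z. -/
theorem sum_overlap_le (hw : ∀ Z, 0 ≤ w Z) (hP : ∀ Z ∈ P, Z ⊆ Λ) {b : Γ → Γ → ℝ}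
    (hb : ∀ x y, ∑ Z ∈ P with x ∈ Z ∧ y ∈ Z, w Z ≤ b x y) {u : Finset Γ → ℝ} {G : Γ → ℝ}
    (hG : ∀ z, 0 ≤ G z) (hu : ∀ Z ∈ P, u Z ≤ ∑ z ∈ Z, G z) (Y : Finset Γ) :
    ∑ Z ∈ P with ¬Disjoint Y Z, w Z * u Z ≤ ∑ y ∈ Y, ∑ z ∈ Λ, b y z * G z := by
  have hterm : ∀ Z, 0 ≤ w Z * ∑ z ∈ Z, G z := fun Z =>
    mul_nonneg (hw Z) (Finset.sum_nonneg fun z _ => hG z)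
  calc ∑ Z ∈ P with ¬Disjoint Y Z, w Z * u Z
      ≤ ∑ Z ∈ P with ¬Disjoint Y Z, ∑ y ∈ Y, if y ∈ Z then w Z * ∑ z ∈ Z, G z else 0 := by
        refine Finset.sum_le_sum fun Z hZ => ?_
        obtain ⟨hZP, hYZ⟩ := Finset.mem_filter.1 hZ
        obtain ⟨y, hy, hyZ⟩ := Finset.not_disjoint_iff.1 hYZ
        refine (mul_le_mul_of_nonneg_left (hu Z hZP) (hw Z)).trans ?_
        refine le_trans (by rw [if_pos hyZ]) (Finset.single_le_sum
          (f := fun y => if y ∈ Z then w Z * ∑ z ∈ Z, G z else 0) (fun y _ => ?_) hy)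
        split_ifs
        exacts [hterm Z, le_rfl]
    _ ≤ ∑ Z ∈ P, ∑ y ∈ Y, if y ∈ Z then w Z * ∑ z ∈ Z, G z else 0 :=
        Finset.sum_le_sum_of_subset_of_nonneg (Finset.filter_subset _ _) fun Z _ _ =>
          Finset.sum_nonneg fun y _ => by split_ifs; exacts [hterm Z, le_rfl]
    _ = ∑ y ∈ Y, ∑ z ∈ Λ, (∑ Z ∈ P with y ∈ Z ∧ z ∈ Z, w Z) * G z := by
        rw [Finset.sum_comm]
        refine Finset.sum_congr rfl fun y _ => ?_
        simp only [Finset.sum_mul, Finset.sum_filter]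
        rw [Finset.sum_comm]
        refine Finset.sum_congr rfl fun Z hZ => ?_
        by_cases hy : y ∈ Z
        · simp only [hy, if_true, true_and]
          simp only [ite_mul, zero_mul]
          rw [← Finset.sum_filter, Finset.filter_mem_eq_inter,
            Finset.inter_eq_right.2 (hP Z hZ), Finset.mul_sum]
        · simp [hy]
    _ ≤ _ := by
        refine Finset.sum_le_sum fun y _ => Finset.sum_le_sum fun z _ => ?_
        exact mul_le_mul_of_nonneg_right (hb y z) (hG z)

/-- Each of the n + 1 links costs M f; each of the n intermediate points is summed out by the
convolution bound at cost C. -/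
theorem chainWeight_succ_le (hw : ∀ Z, 0 ≤ w Z) (hP : ∀ Z ∈ P, Z ⊆ Λ) {f : Γ → Γ → ℝ}
    (hf : ∀ x y, 0 ≤ f x y) {M C : ℝ} (hM : 0 ≤ M) (hC : 0 ≤ C)
    (hb : ∀ x y, ∑ Z ∈ P with x ∈ Z ∧ y ∈ Z, w Z ≤ M * f x y)
    (hconv : ∀ x y, ∑ z ∈ Λ, f x z * f z y ≤ C * f x y) (n : ℕ) (Y : Finset Γ) :
    chainWeight P w X (n + 1) Y ≤ M ^ (n + 1) * C ^ n * ∑ y ∈ Y, ∑ x ∈ X, f y x := by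
  induction n generalizing Y with
  | zero =>
    refine (sum_overlap_le hw hP hb (G := fun z => if z ∈ X then 1 else 0)
      (fun z => by positivity) (fun Z _ => ?_) Y).trans ?_
    · have h0 : ∀ z ∈ Z, (0 : ℝ) ≤ if z ∈ X then 1 else 0 := fun z _ => by positivity
      rw [chainWeight]
      split_ifs with h
      · exact Finset.sum_nonneg h0
      · obtain ⟨z, hz, hzX⟩ := Finset.not_disjoint_iff.1 h
        simpa [hzX] using Finset.single_le_sum h0 hz
    · rw [zero_add, pow_one, pow_zero, mul_one, Finset.mul_sum]
      refine Finset.sum_le_sum fun y _ => ?_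
      simp only [mul_ite, mul_one, mul_zero]
      rw [← Finset.sum_filter, Finset.filter_mem_eq_inter, Finset.mul_sum]
      exact Finset.sum_le_sum_of_subset_of_nonneg Finset.inter_subset_right
        fun x _ _ => mul_nonneg hM (hf y x)
  | succ n ih =>
    refine (sum_overlap_le hw hP hb (G := fun z => M ^ (n + 1) * C ^ n * ∑ x ∈ X, f z x)
      (fun z => mul_nonneg (by positivity) (Finset.sum_nonneg fun x _ => hf z x))
      (fun Z _ => by simpa only [Finset.mul_sum] using ih Z) Y).trans ?_
    rw [Finset.mul_sum]
    refine Finset.sum_le_sum fun y _ => ?_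
    calc ∑ z ∈ Λ, M * f y z * (M ^ (n + 1) * C ^ n * ∑ x ∈ X, f z x)
        = M ^ (n + 2) * C ^ n * ∑ x ∈ X, ∑ z ∈ Λ, f y z * f z x := by
          simp only [Finset.mul_sum]
          rw [Finset.sum_comm]
          exact Finset.sum_congr rfl fun x _ => Finset.sum_congr rfl fun z _ => by ring
      _ ≤ M ^ (n + 2) * C ^ n * ∑ x ∈ X, C * f y x := by
          gcongr with x _
          exact hconv y x
      _ = _ := by rw [← Finset.mul_sum]; ring

end ChainBound

/-! ### Finite range: short chains and the exponential tail -/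

section ChainRange

variable {Γ : Type*} [MetricSpace Γ]

/-- The subsets of `Λ` of diameter at most `R`. -/
noncomputable def smallSubsets (Λ : Finset Γ) (R : ℝ) : Finset (Finset Γ) :=
  Λ.powerset.filter fun Z : Finset Γ => Metric.diam (Z : Set Γ) ≤ R

theorem setDist_le_dist {X Y : Finset Γ} {x y : Γ} (hx : x ∈ X) (hy : y ∈ Y) :
    setDist X Y ≤ dist x y :=
  ciInf_le (f := fun p : X × Y => dist (p.1 : Γ) (p.2 : Γ))
    ⟨0, by rintro _ ⟨p, rfl⟩; exact dist_nonneg⟩ (⟨x, hx⟩, ⟨y, hy⟩)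

variable [DecidableEq Γ] {P : Finset (Finset Γ)} {w : Finset Γ → ℝ} {X : Finset Γ}

/-- A chain of `n` sets of diameter at most `R` covers a distance of at most `n R`. -/
theorem exists_dist_le_of_chainWeight_ne_zero {R : ℝ}
    (hP : ∀ Z ∈ P, Metric.diam (Z : Set Γ) ≤ R) {n : ℕ} {Y : Finset Γ}
    (h : chainWeight P w X n Y ≠ 0) : ∃ x ∈ X, ∃ y ∈ Y, dist x y ≤ n * R := by
  induction n generalizing Y with
  | zero =>
    have hYX : ¬Disjoint Y X := fun hd => h (by rw [chainWeight, if_pos hd])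
    obtain ⟨z, hzY, hzX⟩ := Finset.not_disjoint_iff.1 hYX
    exact ⟨z, hzX, z, hzY, by simp⟩
  | succ n ih =>
    obtain ⟨Z, hZ, hne⟩ := Finset.exists_ne_zero_of_sum_ne_zero h
    obtain ⟨hZP, hYZ⟩ := Finset.mem_filter.1 hZ
    obtain ⟨x, hx, z, hz, hxz⟩ := ih (right_ne_zero_of_mul hne)
    obtain ⟨y, hyY, hyZ⟩ := Finset.not_disjoint_iff.1 hYZ
    refine ⟨x, hx, y, hyY, (dist_triangle x z y).trans ?_⟩
    have hzy : dist z y ≤ R :=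
      (Metric.dist_le_diam_of_mem Z.finite_toSet.isBounded hz hyZ).trans (hP Z hZP)
    push_cast
    linarith

theorem chainWeight_eq_zero_of_lt {R : ℝ} (hR : 0 < R)
    (hP : ∀ Z ∈ P, Metric.diam (Z : Set Γ) ≤ R) {n : ℕ} {Y : Finset Γ}
    (hn : n < ⌈setDist X Y / R⌉₊) : chainWeight P w X n Y = 0 := by
  by_contra h
  obtain ⟨x, hx, y, hy, hxy⟩ := exists_dist_le_of_chainWeight_ne_zero hP h
  have h1 : (n : ℝ) < setDist X Y / R := Nat.lt_ceil.1 hn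
  rw [lt_div_iff₀ hR] at h1
  exact absurd ((setDist_le_dist hx hy).trans hxy) (not_le.2 h1)

end ChainRange

theorem sum_range_le_expTail {s : ℝ} (hs : 0 ≤ s) (k : ℝ) (n : ℕ) :
    ∑ j ∈ Finset.range n, (if ⌈k⌉₊ ≤ j then s ^ j / (j.factorial : ℝ) else 0) ≤ expTail s k := by
  have h1 : expTail s k = ∑' j : ℕ, if ⌈k⌉₊ ≤ j then s ^ j / (j.factorial : ℝ) else 0 := by
    rw [expTail]
    refine (tsum_subtype {j : ℕ | ⌈k⌉₊ ≤ j} fun j => s ^ j / (j.factorial : ℝ)).trans ?_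
    simp only [Set.indicator_apply, Set.mem_ofPred_eq]
  have h0 : ∀ j : ℕ, 0 ≤ if ⌈k⌉₊ ≤ j then s ^ j / (j.factorial : ℝ) else 0 := fun j => by
    positivity
  rw [h1]
  refine Summable.sum_le_tsum _ (fun j _ => h0 j) ?_
  refine Summable.of_nonneg_of_le h0 (fun j => ?_) (Real.summable_pow_div_factorial s)
  split_ifs
  exacts [le_rfl, by positivity]

/-! ### Decay functions and interactions -/

section LocalTerm

variable {Γ : Type*} [DecidableEq Γ] {ι : Γ → Type*} [∀ x, Fintype (ι x)]
  {L : ∀ Z : Finset Γ, LocalAlg ι Z →ₗ[ℂ] LocalAlg ι Z}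

/-- The term of the generator in the volume `Λ` that comes from `Z`. -/
noncomputable def localTerm [∀ x, DecidableEq (ι x)] (L : ∀ Z : Finset Γ, LocalAlg ι Z →ₗ[ℂ] LocalAlg ι Z)
    (Λ Z : Finset Γ) : LocalAlg ι Λ →L[ℂ] LocalAlg ι Λ :=
  if h : Z ⊆ Λ then LinearMap.toContinuousLinearMap (extend h (L Z)) else 0

theorem localTerm_apply [∀ x, DecidableEq (ι x)] {Λ Z : Finset Γ} (h : Z ⊆ Λ) (M : LocalAlg ι Λ) :
    localTerm L Λ Z M = extend h (L Z) M := by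
  rw [localTerm, dif_pos h, LinearMap.coe_toContinuousLinearMap']

end LocalTerm

section Interaction

variable {Γ : Type*} [MetricSpace Γ] {F : ℝ≥0 → ℝ≥0}

/-- The infimum is attained: as F(d(x,y)) is positive and finite, dividing by it turns the condition
into a family of lower bounds on C. -/
theorem isConvBound_convConst (hF : IsFFunction Γ F) : IsConvBound Γ F (convConst Γ F) := by
  intro x y
  have hFne : (F (nndist x y) : ℝ≥0∞) ≠ 0 := by exact_mod_cast (hF.pos _).ne'
  rw [← ENNReal.div_le_iff hFne ENNReal.coe_ne_top]
  obtain ⟨C, hC0, hC⟩ := hF.convolution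
  rw [convConst, ENNReal.coe_sInf (s := {C : ℝ≥0 | 0 < C ∧ IsConvBound Γ F C}) ⟨C, hC0, hC⟩]
  refine le_iInf₂ fun D hD => ?_
  rw [ENNReal.div_le_iff hFne ENNReal.coe_ne_top]
  exact hD.2 x y

/-- The term z = x of the convolution at (x, x) gives F(0)² ≤ C F(0). -/
theorem convConst_pos [Nonempty Γ] (hF : IsFFunction Γ F) : 0 < convConst Γ F := by
  obtain ⟨x⟩ := ‹Nonempty Γ›
  have h1 := isConvBound_convConst hF x x
  have h2 := (ENNReal.le_tsum (f := fun z : Γ =>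
    (F (nndist x z) * F (nndist z x) : ℝ≥0∞)) x).trans h1
  rw [pos_iff_ne_zero]
  intro h0
  rw [h0, ENNReal.coe_zero, zero_mul] at h2
  have := hF.pos (nndist x x)
  simp_all

theorem sum_mul_le_convConst (hF : IsFFunction Γ F) (Λ : Finset Γ) (x y : Γ) :
    ∑ z ∈ Λ, (F (nndist x z) : ℝ) * F (nndist z y) ≤ convConst Γ F * F (nndist x y) := by
  have h := (ENNReal.sum_le_tsum (f := fun z : Γ =>
    (F (nndist x z) * F (nndist z y) : ℝ≥0∞)) Λ).trans (isConvBound_convConst hF x y)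
  exact_mod_cast h

variable [DecidableEq Γ] {ι : Γ → Type*} [∀ x, Fintype (ι x)] [∀ x, DecidableEq (ι x)]
  {L : ∀ Z : Finset Γ, LocalAlg ι Z →ₗ[ℂ] LocalAlg ι Z}

theorem tsum_cbNorm_le (hF : IsFFunction Γ F) (x y : Γ) :
    ∑' Z : {Z : Finset Γ // x ∈ Z ∧ y ∈ Z}, cbNorm (L Z) ≤ FNorm F L * F (nndist x y) := by
  have hFne : (F (nndist x y) : ℝ≥0∞) ≠ 0 := by exact_mod_cast (hF.pos _).ne'
  rw [← ENNReal.div_le_iff hFne ENNReal.coe_ne_top]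
  refine le_sInf fun M hM => ?_
  rw [ENNReal.div_le_iff hFne ENNReal.coe_ne_top]
  exact hM x y

/-- Take x = y ∈ Z in the F-norm bound; the empty set contains no point, so its term is not
controlled. -/
theorem cbNorm_lt_top (hF : IsFFunction Γ F) (hLF : FNorm F L < ∞) {Z : Finset Γ}
    (hZ : Z.Nonempty) : cbNorm (L Z) < ∞ := by
  obtain ⟨x, hx⟩ := hZ
  refine lt_of_le_of_lt ((ENNReal.le_tsum
    (f := fun Z : {Z : Finset Γ // x ∈ Z ∧ x ∈ Z} => cbNorm (L Z)) ⟨Z, hx, hx⟩).trans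
      (tsum_cbNorm_le hF x x)) (ENNReal.mul_lt_top hLF ENNReal.coe_lt_top)

theorem sum_cbNorm_le (hF : IsFFunction Γ F) (hLF : FNorm F L < ∞) (P : Finset (Finset Γ))
    (x y : Γ) : ∑ Z ∈ P with x ∈ Z ∧ y ∈ Z, (cbNorm (L Z)).toReal ≤
      (FNorm F L).toReal * F (nndist x y) := by
  have h1 : ∑ Z ∈ P with x ∈ Z ∧ y ∈ Z, cbNorm (L Z) ≤ FNorm F L * F (nndist x y) := by
    refine le_trans ?_ (tsum_cbNorm_le hF x y)
    rw [← Finset.sum_subtype_eq_sum_filter]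
    exact ENNReal.sum_le_tsum _
  rw [← ENNReal.toReal_sum fun Z hZ =>
    (cbNorm_lt_top hF hLF ⟨x, (Finset.mem_filter.1 hZ).2.1⟩).ne]
  refine (ENNReal.toReal_mono (ENNReal.mul_lt_top hLF ENNReal.coe_lt_top).ne h1).trans_eq ?_
  rw [ENNReal.toReal_mul, ENNReal.coe_toReal]

theorem toContinuousLinearMap_truncGen (Λ : Finset Γ) (R : ℝ) :
    LinearMap.toContinuousLinearMap (truncGen L Λ R) =
      ∑ Z ∈ smallSubsets Λ R, localTerm L Λ Z := by
  rw [truncGen, smallSubsets, map_sum, Finset.sum_filter, Finset.sum_filter, ← Finset.sum_attach Λ.powerset]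
  refine Finset.sum_congr rfl fun Z _ => ?_
  rw [localTerm, dif_pos (Finset.mem_powerset.1 Z.2)]

theorem norm_extend_truncDyn_le_chainWeight (hF : IsFFunction Γ F)
    (hL : IsDissipativeInteraction L) (hLF : FNorm F L < ∞) {X Y Λ : Finset Γ} (hX : X ⊆ Λ)
    (hY : Y ⊆ Λ) (A : LocalAlg ι X) {K : LocalAlg ι Y →ₗ[ℂ] LocalAlg ι Y} (hK : K ∈ CB₀ Y)
    {t : ℝ} (ht : 0 ≤ t) (R : ℝ) (n : ℕ) :
    ‖extend hY K (truncDyn L Λ R t (embed hX A))‖ ≤ (cbNorm K).toReal * ‖A‖ *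
      (∑ j ∈ Finset.range n, t ^ j / (j.factorial : ℝ) *
        chainWeight (smallSubsets Λ R)
          (fun Z => (cbNorm (L Z)).toReal) X j Y +
        t ^ n / (n.factorial : ℝ) *
          (∑ Z ∈ smallSubsets Λ R, (cbNorm (L Z)).toReal) ^ n) := by
  set P := smallSubsets Λ R with hPdef
  have hP : ∀ Z ∈ P, Z ⊆ Λ := fun Z hZ => Finset.mem_powerset.1 (Finset.mem_filter.1 hZ).1
  have hw : ∀ Z : Finset Γ, 0 ≤ (cbNorm (L Z)).toReal := fun Z => ENNReal.toReal_nonneg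
  have h := norm_exp_apply_le_chainWeight (P := P) (X := X) (E := localTerm L Λ) hw
    (fun Z hZ => by
      rw [localTerm, dif_pos (hP Z hZ)]
      exact (hL Z).isNormDissipative_extend (hP Z hZ))
    (fun Z hZ hne v => by
      rw [localTerm_apply (hP Z hZ)]
      exact norm_extend_le (hP Z hZ) (cbNorm_lt_top hF hLF hne) v)
    (fun Z hZ Z' hZ' hd v => by
      simp only [localTerm_apply (hP Z hZ), localTerm_apply (hP Z' hZ')]
      exact extend_comm (hP Z hZ) (hP Z' hZ') hd _ _ v)
    (A := embed hX A)
    (fun Z hZ hd => by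
      rw [localTerm_apply (hP Z hZ)]
      exact extend_embed_eq_zero hX (hP Z hZ) hd (hL Z).map_one A)
    n Y (LinearMap.toContinuousLinearMap (extend hY K)) ENNReal.toReal_nonneg
    (fun v => norm_extend_le hY hK.1 v)
    (fun Z hZ hd v => by
      simp only [localTerm_apply (hP Z hZ)]
      exact extend_comm hY (hP Z hZ) hd K _ v)
    (fun hd => extend_embed_eq_zero hX hY hd hK.2 A) ht
  rw [hPdef, ← toContinuousLinearMap_truncGen] at h
  refine h.trans ?_
  have hnn : 0 ≤ ∑ j ∈ Finset.range n, t ^ j / (j.factorial : ℝ) *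
        chainWeight P (fun Z => (cbNorm (L Z)).toReal) X j Y +
        t ^ n / (n.factorial : ℝ) * (∑ Z ∈ P, (cbNorm (L Z)).toReal) ^ n :=
    add_nonneg (Finset.sum_nonneg fun j _ => mul_nonneg (by positivity)
      (chainWeight_nonneg hw j Y)) (mul_nonneg (by positivity)
        (pow_nonneg (Finset.sum_nonneg fun Z _ => hw Z) n))
  exact mul_le_mul_of_nonneg_right
    (mul_le_mul_of_nonneg_left (norm_embed_le hX A) ENNReal.toReal_nonneg) hnn

theorem sum_chainWeight_le (hF : IsFFunction Γ F) (hLF : FNorm F L < ∞) {X Y Λ : Finset Γ}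
    (hXY : Disjoint X Y) {t R : ℝ} (ht : 0 ≤ t) (hR : 0 < R) (n : ℕ) :
    ∑ j ∈ Finset.range n, t ^ j / (j.factorial : ℝ) *
        chainWeight (smallSubsets Λ R)
          (fun Z => (cbNorm (L Z)).toReal) X j Y ≤
      1 / (convConst Γ F : ℝ) * expTail ((FNorm F L).toReal * (convConst Γ F : ℝ) * t)
        (setDist X Y / R) * ∑ x ∈ X, ∑ y ∈ Y, (F (nndist x y) : ℝ) := by
  set P := smallSubsets Λ R
  set a := chainWeight P (fun Z => (cbNorm (L Z)).toReal) X
  set M := (FNorm F L).toReal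
  set C := (convConst Γ F : ℝ)
  set S := ∑ x ∈ X, ∑ y ∈ Y, (F (nndist x y) : ℝ) with hS
  have hM : 0 ≤ M := ENNReal.toReal_nonneg
  have hC : 0 ≤ C := NNReal.coe_nonneg _
  have hS0 : 0 ≤ S := by positivity
  have hzero : ∀ j < ⌈setDist X Y / R⌉₊, a j Y = 0 := fun j hj =>
    chainWeight_eq_zero_of_lt hR (fun Z hZ => (Finset.mem_filter.1 hZ).2) hj
  have hsucc : ∀ j, a (j + 1) Y ≤ M ^ (j + 1) * C ^ j * S := fun j => by
    have h := chainWeight_succ_le (X := X) (P := P) (Λ := Λ)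
      (f := fun x y => (F (nndist x y) : ℝ)) (fun Z => ENNReal.toReal_nonneg)
      (fun Z hZ => Finset.mem_powerset.1 (Finset.mem_filter.1 hZ).1)
      (fun x y => NNReal.coe_nonneg _) hM hC (sum_cbNorm_le hF hLF P)
      (sum_mul_le_convConst hF Λ) j Y
    rw [Finset.sum_comm] at h
    simpa only [hS, nndist_comm] using h
  have hterm : ∀ j, t ^ j / (j.factorial : ℝ) * a j Y ≤ 1 / C *
      (if ⌈setDist X Y / R⌉₊ ≤ j then (M * C * t) ^ j / (j.factorial : ℝ) else 0) * S := by
    intro j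
    split_ifs with hj
    · rcases j with - | j
      -- The chain bound starts at one link; the chain of length 0 is excluded by disjointness. This
      -- case arises only when `setDist X Y` is 0.
      · have h0 : a 0 Y = 0 := if_pos hXY.symm
        rw [h0, mul_zero]
        positivity
      · rcases hC.eq_or_lt with hC0 | hC0
        -- C = 0 forces Γ to be empty; then 1 / C is 0 by convention, and the left side is
        -- nonpositive because X is empty.
        · have hΓ : IsEmpty Γ := by
            by_contra hne
            rw [not_isEmpty_iff] at hne
            exact absurd hC0 (NNReal.coe_pos.2 (convConst_pos hF)).ne
          have h1 := hsucc j
          rw [hS, Finset.eq_empty_of_isEmpty X] at h1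
          simp only [Finset.sum_empty, mul_zero] at h1
          rw [← hC0, div_zero, zero_mul, zero_mul]
          exact mul_nonpos_of_nonneg_of_nonpos (by positivity) h1
        · calc t ^ (j + 1) / ((j + 1).factorial : ℝ) * a (j + 1) Y
              ≤ t ^ (j + 1) / ((j + 1).factorial : ℝ) * (M ^ (j + 1) * C ^ j * S) := by
                gcongr
                exact hsucc j
            _ = _ := by
                field_simp
                ring
    · rw [hzero j (not_le.1 hj)]
      simp
  refine (Finset.sum_le_sum fun j _ => hterm j).trans ?_
  rw [← Finset.sum_mul, ← Finset.mul_sum]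
  gcongr
  exact sum_range_le_expTail (by positivity) _ n

end Interaction

end OpenSpin

theorem theorem2p1 {Γ : Type*} [MetricSpace Γ] [Countable Γ] [DecidableEq Γ]
    {ι : Γ → Type*} [∀ x, Fintype (ι x)] [∀ x, DecidableEq (ι x)]
    {F : ℝ≥0 → ℝ≥0} (hF : OpenSpin.IsFFunction Γ F)
    {L : ∀ Z : Finset Γ, OpenSpin.LocalAlg ι Z →ₗ[ℂ] OpenSpin.LocalAlg ι Z}
    (hL : OpenSpin.IsDissipativeInteraction L) (hLF : OpenSpin.FNorm F L < ∞)
    {X Y : Finset Γ} (hXY : Disjoint X Y)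
    {Λ : Finset Γ} (hX : X ⊆ Λ) (hY : Y ⊆ Λ)
    (A : OpenSpin.LocalAlg ι X)
    {K : OpenSpin.LocalAlg ι Y →ₗ[ℂ] OpenSpin.LocalAlg ι Y} (hK : K ∈ OpenSpin.CB₀ Y)
    {t R : ℝ} (ht : 0 ≤ t) (hR : 0 < R) :
    ‖OpenSpin.extend hY K (OpenSpin.truncDyn L Λ R t (OpenSpin.embed hX A))‖ ≤
      (OpenSpin.cbNorm K).toReal * ‖A‖ / (OpenSpin.convConst Γ F : ℝ) *
        OpenSpin.expTail ((OpenSpin.FNorm F L).toReal * (OpenSpin.convConst Γ F : ℝ) * t)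
          (OpenSpin.setDist X Y / R) *
        ∑ x ∈ X, ∑ y ∈ Y, (F (nndist x y) : ℝ) := by
  set l := ∑ Z ∈ OpenSpin.smallSubsets Λ R, (OpenSpin.cbNorm (L Z)).toReal
  set k := (OpenSpin.cbNorm K).toReal * ‖A‖ with hk
  have hk0 : 0 ≤ k := mul_nonneg ENNReal.toReal_nonneg (norm_nonneg A)
  set b := 1 / (OpenSpin.convConst Γ F : ℝ) *
    OpenSpin.expTail ((OpenSpin.FNorm F L).toReal * (OpenSpin.convConst Γ F : ℝ) * t)
      (OpenSpin.setDist X Y / R) * ∑ x ∈ X, ∑ y ∈ Y, (F (nndist x y) : ℝ) with hb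
  -- The bound b does not depend on n, and l is a fixed number because Λ is finite, so the remainder
  -- disappears as n → ∞.
  have hlim : Filter.Tendsto (fun n : ℕ => k * (b + (t * l) ^ n / (n.factorial : ℝ)))
      Filter.atTop (nhds (k * (b + 0))) :=
    ((FloorSemiring.tendsto_pow_div_factorial_atTop (t * l)).const_add b).const_mul k
  refine (ge_of_tendsto' hlim fun n => ?_).trans_eq (by rw [hb]; ring)
  refine (OpenSpin.norm_extend_truncDyn_le_chainWeight hF hL hLF hX hY A hK ht R n).trans ?_
  refine mul_le_mul_of_nonneg_left (add_le_add
    (OpenSpin.sum_chainWeight_le hF hLF hXY ht hR n) (le_of_eq ?_)) hk0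
  rw [mul_pow]
  ring
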